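/- Let $\Omega\subset\mathbb R^d$ be a bounded domain (non-empty, open, connected), let $\mathcal S$ be a collection of subsets of $\mathbb R^d$ with $\Omega\in\mathcal S$, and let $\mathcal J:\mathcal S\to\mathbb R$. Let $\mathrm{Lip}_1(\Omega;\mathbb R^d)$ be the set of $V:\Omega\to\mathbb R^d$ with $|V(x)-V(y)|\le|x-y|$ for all $x,y\in\Omega$, where $|\cdot|$ is the Euclidean norm. Let $U$ be either $$\Big\{V\in \mathrm{Lip}_1(\Omega;\mathbb R^d): \int_\Omega \big(V(x)+x\,\mathrm{Div}\,V(x)\big)\,dx=0\Big\}$$ or $$\big\{V\in \mathrm{Lip}_1(\Omega;\mathbb R^d): V|_\Sigma=0\big\},$$ where $\Sigma\subset\partial\Omega$ is non-empty and $V|_\Sigma$ is understood through the continuous extension of $V$ to $\overline\Omega$. For $V\in \mathrm{Lip}_1(\Omega;\mathbb R^d)$ and $t\ge0$ put $\Omega_t(V)=\{x+tV(x):x\in\Omega\}$, and call $\mathcal J$ differentiable at $\Omega$ in direction $V$ if $\Omega_t(V)\in\mathcal S$ for all sufficiently small $t\ge 0$ and the limit $$\mathcal J'(\Omega)[V]=\lim_{t\to0^+}\frac{\mathcal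 J(\Omega_t(V))-\mathcal J(\Omega)}{t}\in\mathbb R$$ exists. Suppose that $\mathcal J$ is differentiable at $\Omega$ in every direction $V\in U$ and that there are $S_1\in L^1(\Omega;\mathbb R^{d\times d})$ and $S_0\in L^1(\Omega;\mathbb R^d)$ such that $$\mathcal J'(\Omega)[V]=\int_\Omega \big(S_1:DV+S_0\cdot V\big)\,dx\qquad\text{for all }V\in U,$$ where $(DV)_{ij}=\partial_jV_i$ is the almost everywhere defined derivative, $\mathrm{Div}\,V$ is the trace of $DV$, and $A:B=\sum_{i,j}A_{ij}B_{ij}$. Then there exists $V\in U$ such that $$\mathcal J'(\Omega)[V]=\inf\{\mathcal J'(\Omega)[V']:V'\in U\}.$$ -/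

import Mathlib

open MeasureTheory Filter Topology

namespace ShapeOpt

noncomputable section

/- A vector field on the open set `Ω ⊆ ℝ^d` is represented by a map `V : ℝ^d → ℝ^d`. Everything below
depends only on the values of `V` on `Ω`. -/

/-- The set `Lip₁(Ω; ℝ^d)` of vector fields with `|V x - V y| ≤ |x - y|` for all `x, y ∈ Ω`
(Euclidean norms). -/
def lipOne {d : ℕ} (Ω : Set (EuclideanSpace ℝ (Fin d))) :
    Set (EuclideanSpace ℝ (Fin d) → EuclideanSpace ℝ (Fin d)) :=
  {V | ∀ x ∈ Ω, ∀ y ∈ Ω, ‖V x - V y‖ ≤ ‖x - y‖}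

/-- The perturbed set `Ω_t(V) = {x + t V(x) : x ∈ Ω}`. -/
def perturb {d : ℕ} (Ω : Set (EuclideanSpace ℝ (Fin d)))
    (V : EuclideanSpace ℝ (Fin d) → EuclideanSpace ℝ (Fin d)) (t : ℝ) :
    Set (EuclideanSpace ℝ (Fin d)) :=
  (fun x => x + t • V x) '' Ω

/-- The one-sided difference quotient of the shape functional `J` at `Ω` in direction `V`. -/
def shapeQuotient {d : ℕ} (J : Set (EuclideanSpace ℝ (Fin d)) → ℝ)
    (Ω : Set (EuclideanSpace ℝ (Fin d)))
    (V : EuclideanSpace ℝ (Fin d) → EuclideanSpace ℝ (Fin d)) (t : ℝ) : ℝ :=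
  (J (perturb Ω V t) - J Ω) / t

/-- `J : 𝒮 → ℝ` is (semi-)differentiable at `Ω ∈ 𝒮` in direction `V`: the sets `Ω_t(V)` belong to
`𝒮` for all small `t ≥ 0`, and the difference quotients converge as `t → 0⁺`.
Only the values of `J` on `𝒮` matter. -/
def ShapeDifferentiableAt {d : ℕ} (𝒮 : Set (Set (EuclideanSpace ℝ (Fin d))))
    (J : Set (EuclideanSpace ℝ (Fin d)) → ℝ) (Ω : Set (EuclideanSpace ℝ (Fin d)))
    (V : EuclideanSpace ℝ (Fin d) → EuclideanSpace ℝ (Fin d)) : Prop :=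
  (∃ ε : ℝ, 0 < ε ∧ ∀ t : ℝ, 0 ≤ t → t < ε → perturb Ω V t ∈ 𝒮) ∧
    ∃ L : ℝ, Tendsto (shapeQuotient J Ω V) (𝓝[>] 0) (𝓝 L)

/-- The shape derivative `J'(Ω)[V] = lim_{t → 0⁺} (J(Ω_t(V)) - J(Ω)) / t`. -/
def shapeDeriv {d : ℕ} (J : Set (EuclideanSpace ℝ (Fin d)) → ℝ)
    (Ω : Set (EuclideanSpace ℝ (Fin d)))
    (V : EuclideanSpace ℝ (Fin d) → EuclideanSpace ℝ (Fin d)) : ℝ :=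
  limUnder (𝓝[>] (0 : ℝ)) (shapeQuotient J Ω V)

/-- The Jacobian matrix `(DV)_{ij} = ∂_j V_i`. For a Lipschitz field on an open set it is the
classical derivative at almost every point (and hence the weak derivative). -/
def jacobian {d : ℕ} (V : EuclideanSpace ℝ (Fin d) → EuclideanSpace ℝ (Fin d))
    (x : EuclideanSpace ℝ (Fin d)) : Matrix (Fin d) (Fin d) ℝ :=
  Matrix.of fun i j => (fderiv ℝ V x (EuclideanSpace.single j 1)) i

/-- The divergence `Div V = tr DV`. -/
def divergence {d : ℕ} (V : EuclideanSpace ℝ (Fin d) → EuclideanSpace ℝ (Fin d))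
    (x : EuclideanSpace ℝ (Fin d)) : ℝ :=
  (jacobian V x).trace

/-- The Frobenius product `A : B = ∑ i j, A_{ij} B_{ij}`. -/
def frobenius {d : ℕ} (A B : Matrix (Fin d) (Fin d) ℝ) : ℝ :=
  ∑ i, ∑ j, A i j * B i j

/-- The `V ∈ Lip₁(Ω; ℝ^d)` fixing the centre of mass at the origin to first order:
`∫_Ω V + id Div V = 0`. -/
def centredFields {d : ℕ} (Ω : Set (EuclideanSpace ℝ (Fin d))) :
    Set (EuclideanSpace ℝ (Fin d) → EuclideanSpace ℝ (Fin d)) :=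
  {V | V ∈ lipOne Ω ∧ ∫ x in Ω, (V x + divergence V x • x) = 0}

/-- The `V ∈ Lip₁(Ω; ℝ^d)` with `V = 0` on the boundary part `Γ ⊆ ∂Ω`, i.e. the continuous
extension of `V` from `Ω` to its closure vanishes on `Γ`. -/
def clampedFields {d : ℕ} (Ω Γ : Set (EuclideanSpace ℝ (Fin d))) :
    Set (EuclideanSpace ℝ (Fin d) → EuclideanSpace ℝ (Fin d)) :=
  {V | V ∈ lipOne Ω ∧ ∀ s ∈ Γ, Tendsto V (𝓝[Ω] s) (𝓝 0)}

end

end ShapeOpt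

namespace ShapeOpt

open scoped NNReal ContDiff

/-! This is the direct method. On `U` the shape derivative is `V ↦ ∫_Ω S₁ : DV + S₀ ⋅ V`. Either
constraint bounds `V a` at a fixed `a ∈ Ω`, so by Arzelà–Ascoli any sequence in `U` has a pointwise
convergent subsequence. Its Jacobians are bounded and converge weakly-* in `L^∞`, which is exactly
what an `L¹` density `S₁` needs; `S₀` is handled by dominated convergence
(`exists_subseq_tendsto_functional`).

The limit stays in `U`. The centring constraint consists of `d` functionals of the same form; the
clamping constraint amounts to `‖V x‖ ≤ ‖x - s‖` for `s ∈ Γ`, which survives pointwise limits.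
Applied to a minimizing sequence, this gives a minimizer. -/

/-- Sequential form of the Arzelà–Ascoli theorem: uniformly Lipschitz maps which are bounded at one
point have a pointwise convergent subsequence. -/
theorem exists_subseq_tendsto_of_lipschitzWith {X Y : Type*} [MetricSpace X] [ProperSpace X]
    [MetricSpace Y] [ProperSpace Y] {C : ℝ≥0} {f : ℕ → X → Y}
    (hf : ∀ n, LipschitzWith C (f n)) {a : X} {b : Y} {M : ℝ} (hM : ∀ n, dist (f n a) b ≤ M) :
    ∃ g : X → Y, LipschitzWith C g ∧ ∃ φ : ℕ → ℕ, StrictMono φ ∧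
      ∀ x, Tendsto (fun n => f (φ n) x) atTop (𝓝 (g x)) := by
  let S : Set C(X, Y) := {g | LipschitzWith C g ∧ dist (g a) b ≤ M}
  have hS : IsCompact S := by
    apply ArzelaAscoli.isCompact_of_equicontinuous
    · have himage : ContinuousMap.toFun '' S = {g : X → Y | LipschitzWith C g ∧ dist (g a) b ≤ M} := by
        ext g
        constructor
        · rintro ⟨h, hh, rfl⟩
          exact hh
        · rintro hg
          exact ⟨⟨g, hg.1.continuous⟩, hg, rfl⟩
      rw [himage]
      -- By Tychonoff: the Lipschitz bound and the bound at `a` confine each value `g x` to a fixed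
      -- ball.
      refine IsCompact.of_isClosed_subset
        (isCompact_univ_pi fun x => isCompact_closedBall b (C * dist x a + M)) ?_ ?_
      · refine IsClosed.inter (isClosed_setOfPred_lipschitzWith C) ?_
        exact isClosed_le ((continuous_apply a).dist continuous_const) continuous_const
      · intro g hg x _
        have h1 := dist_triangle (g x) (g a) b
        have h2 := hg.1.dist_le_mul x a
        have h3 := hg.2
        simp only [Metric.mem_closedBall]
        linarith
    · exact LipschitzWith.uniformEquicontinuous _ C (fun g => g.2.1) |>.equicontinuous
  obtain ⟨g, hg, φ, hφ, hlim⟩ := hS.tendsto_subseq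
    (x := fun n => (⟨f n, (hf n).continuous⟩ : C(X, Y))) (fun n => ⟨hf n, hM n⟩)
  exact ⟨g, hg.1, φ, hφ, fun x => ((continuous_eval_const x).tendsto g).comp hlim⟩

/-! ### Weak-* convergence of derivatives of Lipschitz functions. -/

theorem integrable_lineDeriv_mul {E : Type*} [NormedAddCommGroup E] [NormedSpace ℝ E]
    [LocallyCompactSpace E] [SecondCountableTopology E] [MeasurableSpace E] [BorelSpace E]
    {μ : Measure E} {C : ℝ≥0} {f g : E → ℝ} (hf : LipschitzWith C f) (hg : Integrable g μ)
    (v : E) : Integrable (fun x => lineDeriv ℝ f x v * g x) μ :=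
  hg.bdd_mul (aestronglyMeasurable_lineDeriv hf.continuous μ)
    (Eventually.of_forall fun _ => norm_lineDeriv_le_of_lipschitz ℝ hf)

/-- Replacing the weight costs an `L¹` error that is uniform over all `C`-Lipschitz `f`; this is
what permits approximating the weight by test functions. -/
theorem norm_integral_lineDeriv_mul_sub_le {E : Type*} [NormedAddCommGroup E]
    [NormedSpace ℝ E] [LocallyCompactSpace E] [SecondCountableTopology E] [MeasurableSpace E]
    [BorelSpace E] {μ : Measure E} {C : ℝ≥0} {f g h : E → ℝ} (hf : LipschitzWith C f)
    (hg : Integrable g μ) (hh : Integrable h μ) (v : E) :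
    ‖(∫ x, lineDeriv ℝ f x v * g x ∂μ) - ∫ x, lineDeriv ℝ f x v * h x ∂μ‖ ≤
      C * ‖v‖ * ∫ x, ‖g x - h x‖ ∂μ := by
  rw [← integral_sub (integrable_lineDeriv_mul hf hg v) (integrable_lineDeriv_mul hf hh v),
    ← integral_const_mul]
  refine norm_integral_le_of_norm_le ((hg.sub hh).norm.const_mul _)
    (Eventually.of_forall fun x => ?_)
  rw [← mul_sub, norm_mul]
  gcongr
  exact norm_lineDeriv_le_of_lipschitz ℝ hf

section WeakConvergence

variable {E : Type*} [NormedAddCommGroup E] [NormedSpace ℝ E] [FiniteDimensional ℝ E]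
  [MeasurableSpace E] [BorelSpace E] {μ : Measure E} [μ.IsAddHaarMeasure]

/-- Integration by parts moves the derivative onto `φ`, after which pointwise convergence of `f n`
suffices. -/
theorem tendsto_integral_lineDeriv_mul_of_contDiff {C : ℝ≥0} {f : ℕ → E → ℝ} {g : E → ℝ}
    (hf : ∀ n, LipschitzWith C (f n)) (hg : LipschitzWith C g)
    (hlim : ∀ x, Tendsto (fun n => f n x) atTop (𝓝 (g x))) {φ : E → ℝ} (hφ : ContDiff ℝ ∞ φ)
    (hφc : HasCompactSupport φ) (v : E) :
    Tendsto (fun n => ∫ x, lineDeriv ℝ (f n) x v * φ x ∂μ) atTop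
      (𝓝 (∫ x, lineDeriv ℝ g x v * φ x ∂μ)) := by
  obtain ⟨D, hD⟩ := hφ.lipschitzWith_of_hasCompactSupport hφc (by simp)
  simp_rw [fun n => (hf n).integral_lineDeriv_mul_eq (μ := μ) hD hφc v,
    hg.integral_lineDeriv_mul_eq (μ := μ) hD hφc v]
  have hline : ∀ x, lineDeriv ℝ φ x (-v) = fderiv ℝ φ x (-v) := fun x =>
    ((hφ.differentiable (by simp)) x).lineDeriv_eq_fderiv
  simp_rw [hline]
  obtain ⟨B, hB⟩ := (hlim 0).norm.bddAbove_range
  have hcont : Continuous fun x => fderiv ℝ φ x (-v) :=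
    (hφ.continuous_fderiv (by simp)).clm_apply continuous_const
  refine tendsto_integral_of_dominated_convergence
    (fun x => ‖fderiv ℝ φ x (-v)‖ * (C * ‖x‖ + B)) ?_ ?_ ?_ ?_
  · exact fun n => (hcont.mul (hf n).continuous).aestronglyMeasurable
  · refine Continuous.integrable_of_hasCompactSupport (by fun_prop) ?_
    exact ((hφc.fderiv_apply (𝕜 := ℝ) (-v)).norm).mul_right
  · refine fun n => Eventually.of_forall fun x => ?_
    rw [norm_mul]
    gcongr
    have h1 : ‖f n 0‖ ≤ B := hB ⟨n, rfl⟩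
    have h2 := (hf n).norm_sub_le x 0
    have h3 := norm_sub_norm_le (f n x) (f n 0)
    rw [sub_zero] at h2
    linarith
  · exact Eventually.of_forall fun x => (hlim x).const_mul _

/-- Derivatives of pointwise convergent, uniformly Lipschitz functions converge weakly-* in `L^∞`. -/
theorem tendsto_integral_lineDeriv_mul {C : ℝ≥0} {f : ℕ → E → ℝ} {g : E → ℝ}
    (hf : ∀ n, LipschitzWith C (f n)) (hg : LipschitzWith C g)
    (hlim : ∀ x, Tendsto (fun n => f n x) atTop (𝓝 (g x))) {w : E → ℝ} (hw : Integrable w μ)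
    (v : E) :
    Tendsto (fun n => ∫ x, lineDeriv ℝ (f n) x v * w x ∂μ) atTop
      (𝓝 (∫ x, lineDeriv ℝ g x v * w x ∂μ)) := by
  rw [Metric.tendsto_atTop']
  intro ε hε
  -- The `+ 1` keeps the denominator positive when `C * ‖v‖ = 0`.
  set δ : ℝ := ε / (3 * (C * ‖v‖ + 1)) with hδ
  have hδpos : 0 < δ := by positivity
  have hw1 : MemLp w 1 μ := memLp_one_iff_integrable.2 hw
  obtain ⟨φ, hφc, hφ, hle⟩ := hw1.exist_eLpNorm_sub_le (by simp) le_rfl hδpos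
  have hφi : Integrable φ μ := hφ.continuous.integrable_of_hasCompactSupport hφc
  have hint : ∫ x, ‖w x - φ x‖ ∂μ ≤ δ := by
    rw [eLpNorm_one_eq_lintegral_enorm] at hle
    change ∫ x, ‖(w - φ) x‖ ∂μ ≤ δ
    rw [integral_norm_eq_lintegral_enorm (hw.sub hφi).aestronglyMeasurable]
    exact ENNReal.toReal_le_of_le_ofReal hδpos.le hle
  have hsmall : ∀ h : E → ℝ, LipschitzWith C h →
      ‖(∫ x, lineDeriv ℝ h x v * w x ∂μ) - ∫ x, lineDeriv ℝ h x v * φ x ∂μ‖ < ε / 3 := by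
    intro h hh
    refine (norm_integral_lineDeriv_mul_sub_le hh hw hφi v).trans_lt ?_
    calc (C : ℝ) * ‖v‖ * ∫ x, ‖w x - φ x‖ ∂μ ≤ C * ‖v‖ * δ := by gcongr
      _ < (C * ‖v‖ + 1) * δ := by gcongr; linarith
      _ = ε / 3 := by rw [hδ]; field_simp
  obtain ⟨N, hN⟩ := (Metric.tendsto_atTop'.1
    (tendsto_integral_lineDeriv_mul_of_contDiff (μ := μ) hf hg hlim hφ hφc v)) (ε / 3) (by positivity)
  refine ⟨N, fun n hn => ?_⟩
  have h1 := hsmall _ (hf n)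
  have h2 := hsmall _ hg
  have h3 := hN n hn
  rw [Real.norm_eq_abs, abs_lt] at h1 h2
  rw [Real.dist_eq, abs_lt] at h3 ⊢
  constructor <;> linarith [h1.1, h1.2, h2.1, h2.2, h3.1, h3.2]

end WeakConvergence

/-! ### Compactness of `lipOne Ω` and continuity of the linear functionals. -/

variable {d : ℕ} {Ω : Set (EuclideanSpace ℝ (Fin d))}

theorem lipschitzOnWith_of_mem_lipOne {V : EuclideanSpace ℝ (Fin d) → EuclideanSpace ℝ (Fin d)}
    (hV : V ∈ lipOne Ω) : LipschitzOnWith 1 V Ω :=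
  LipschitzOnWith.of_dist_le_mul fun x hx y hy => by
    simpa [dist_eq_norm] using hV x hx y hy

/-- Valid at every point of `Ω`, since `fderiv` is zero where `V` is not differentiable. -/
theorem abs_jacobian_le {V : EuclideanSpace ℝ (Fin d) → EuclideanSpace ℝ (Fin d)}
    (hΩ : IsOpen Ω) (hV : V ∈ lipOne Ω) {x : EuclideanSpace ℝ (Fin d)} (hx : x ∈ Ω) (i j : Fin d) :
    |jacobian V x i j| ≤ 1 := by
  have h1 : ‖fderiv ℝ V x‖ ≤ (1 : ℝ≥0) :=
    norm_fderiv_le_of_lipschitzOn ℝ (hΩ.mem_nhds hx) (lipschitzOnWith_of_mem_lipOne hV)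
  calc |jacobian V x i j| ≤ ‖fderiv ℝ V x (EuclideanSpace.single j 1)‖ :=
        PiLp.norm_apply_le (fderiv ℝ V x (EuclideanSpace.single j 1)) i
    _ ≤ ‖fderiv ℝ V x‖ * ‖(EuclideanSpace.single j 1 : EuclideanSpace ℝ (Fin d))‖ :=
        (fderiv ℝ V x).le_opNorm _
    _ ≤ 1 := by simpa using h1

theorem measurable_jacobian (V : EuclideanSpace ℝ (Fin d) → EuclideanSpace ℝ (Fin d)) (i j : Fin d) :
    Measurable fun x => jacobian V x i j := by
  have h := measurable_fderiv_apply_const ℝ V (EuclideanSpace.single j 1)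
  exact (EuclideanSpace.proj (𝕜 := ℝ) i).continuous.measurable.comp h

theorem jacobian_congr {V W : EuclideanSpace ℝ (Fin d) → EuclideanSpace ℝ (Fin d)}
    (hΩ : IsOpen Ω) (h : Set.EqOn V W Ω) {x : EuclideanSpace ℝ (Fin d)} (hx : x ∈ Ω) :
    jacobian V x = jacobian W x := by
  simp only [jacobian, (h.eventuallyEq_of_mem (hΩ.mem_nhds hx)).fderiv_eq]

theorem lipschitzWith_coord {W : EuclideanSpace ℝ (Fin d) → EuclideanSpace ℝ (Fin d)} {C : ℝ≥0}
    (hW : LipschitzWith C W) (i : Fin d) : LipschitzWith C fun x => W x i :=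
  LipschitzWith.of_dist_le_mul fun x y => by
    refine le_trans ?_ (hW.dist_le_mul x y)
    simpa [dist_eq_norm] using PiLp.norm_apply_le (W x - W y) i

theorem jacobian_ae_eq_lineDeriv {W : EuclideanSpace ℝ (Fin d) → EuclideanSpace ℝ (Fin d)} {C : ℝ≥0}
    (hW : LipschitzWith C W) (i j : Fin d) :
    (fun x => jacobian W x i j) =ᵐ[volume]
      fun x => lineDeriv ℝ (fun y => W y i) x (EuclideanSpace.single j 1) := by
  filter_upwards [hW.ae_differentiableAt (μ := volume)] with x hx
  have h := ((EuclideanSpace.proj (𝕜 := ℝ) i).hasFDerivAt.comp x hx.hasFDerivAt)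
  exact (h.hasLineDerivAt (EuclideanSpace.single j 1)).lineDeriv.symm

/-- Reduces to the whole space: `V` is arbitrary off `Ω`, so it is traded for a global Lipschitz
extension `W`, and the restriction to `Ω` is absorbed into the weight. -/
theorem setIntegral_mul_jacobian {V W : EuclideanSpace ℝ (Fin d) → EuclideanSpace ℝ (Fin d)}
    {C : ℝ≥0} (hΩ : IsOpen Ω) (hW : LipschitzWith C W) (h : Set.EqOn V W Ω)
    (w : EuclideanSpace ℝ (Fin d) → ℝ) (i j : Fin d) :
    ∫ x in Ω, w x * jacobian V x i j =
      ∫ x, lineDeriv ℝ (fun y => W y i) x (EuclideanSpace.single j 1) * Ω.indicator w x := by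
  rw [← integral_indicator hΩ.measurableSet]
  refine integral_congr_ae ?_
  filter_upwards [jacobian_ae_eq_lineDeriv hW i j] with x hx
  by_cases hxΩ : x ∈ Ω
  · simp only [Set.indicator_of_mem hxΩ, jacobian_congr hΩ h hxΩ, ← hx, mul_comm]
  · simp [Set.indicator_of_notMem hxΩ]

/-- Compactness of `Lip₁(Ω; ℝ^d)`: fields bounded at one point have a subsequence which converges
pointwise and whose Jacobians converge weakly-* in `L^∞(Ω)`. -/
theorem exists_subseq_tendsto_of_lipOne (hΩ : IsOpen Ω)
    {V : ℕ → EuclideanSpace ℝ (Fin d) → EuclideanSpace ℝ (Fin d)} (hV : ∀ n, V n ∈ lipOne Ω)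
    {a : EuclideanSpace ℝ (Fin d)} (ha : a ∈ Ω) {M : ℝ} (hM : ∀ n, ‖V n a‖ ≤ M) :
    ∃ W ∈ lipOne Ω, ∃ φ : ℕ → ℕ, StrictMono φ ∧
      (∀ x ∈ Ω, Tendsto (fun n => V (φ n) x) atTop (𝓝 (W x))) ∧
      ∀ (w : EuclideanSpace ℝ (Fin d) → ℝ), IntegrableOn w Ω volume → ∀ i j,
        Tendsto (fun n => ∫ x in Ω, w x * jacobian (V (φ n)) x i j) atTop
          (𝓝 (∫ x in Ω, w x * jacobian W x i j)) := by
  choose f hfL hfV using fun n =>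
    (lipschitzOnWith_of_mem_lipOne (hV n)).extend_finite_dimension
  obtain ⟨W, hWL, φ, hφ, hlim⟩ := exists_subseq_tendsto_of_lipschitzWith hfL
    (a := a) (b := 0) (M := M) (fun n => by rw [← hfV n ha, dist_zero_right]; exact hM n)
  have hlimΩ : ∀ x ∈ Ω, Tendsto (fun n => V (φ n) x) atTop (𝓝 (W x)) := fun x hx => by
    simpa only [hfV _ hx] using hlim x
  refine ⟨W, fun x hx y hy => ?_, φ, hφ, hlimΩ, fun w hw i j => ?_⟩
  -- The extensions may have a Lipschitz constant larger than 1; the constant 1 is recovered from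
  -- the original fields on `Ω`.
  · exact le_of_tendsto ((hlimΩ x hx).sub (hlimΩ y hy)).norm
      (Eventually.of_forall fun n => hV (φ n) x hx y hy)
  · simp_rw [fun n => setIntegral_mul_jacobian hΩ (hfL (φ n)) (hfV (φ n)) w i j,
      setIntegral_mul_jacobian hΩ hWL (Set.eqOn_refl W Ω) w i j]
    refine tendsto_integral_lineDeriv_mul (fun n => lipschitzWith_coord (hfL (φ n)) i)
      (lipschitzWith_coord hWL i) (fun x => ?_) (hw.integrable_indicator hΩ.measurableSet) _
    exact ((EuclideanSpace.proj (𝕜 := ℝ) i).continuous.tendsto _).comp (hlim x)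

theorem integrableOn_mul_jacobian {V : EuclideanSpace ℝ (Fin d) → EuclideanSpace ℝ (Fin d)}
    (hΩ : IsOpen Ω) (hV : V ∈ lipOne Ω) {w : EuclideanSpace ℝ (Fin d) → ℝ}
    (hw : IntegrableOn w Ω volume) (i j : Fin d) :
    IntegrableOn (fun x => w x * jacobian V x i j) Ω volume := by
  refine Integrable.mul_bdd (c := 1) hw (measurable_jacobian V i j).aestronglyMeasurable ?_
  filter_upwards [ae_restrict_mem hΩ.measurableSet] with x hx
  exact abs_jacobian_le hΩ hV hx i j

theorem aestronglyMeasurable_of_mem_lipOne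
    {V : EuclideanSpace ℝ (Fin d) → EuclideanSpace ℝ (Fin d)} (hΩ : IsOpen Ω) (hV : V ∈ lipOne Ω) :
    AEStronglyMeasurable V (volume.restrict Ω) :=
  (lipschitzOnWith_of_mem_lipOne hV).continuousOn.aestronglyMeasurable hΩ.measurableSet

theorem exists_bound_of_isBounded (hb : Bornology.IsBounded Ω) {a : EuclideanSpace ℝ (Fin d)}
    (ha : a ∈ Ω) (M : ℝ) : ∃ B, ∀ V ∈ lipOne Ω, ‖V a‖ ≤ M → ∀ x ∈ Ω, ‖V x‖ ≤ B := by
  obtain ⟨R, hR⟩ := hb.subset_closedBall a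
  refine ⟨R + M, fun V hV hVa x hx => ?_⟩
  have h1 := hV x hx a ha
  have h2 := norm_sub_norm_le (V x) (V a)
  have h3 : ‖x - a‖ ≤ R := mem_closedBall_iff_norm.1 (hR hx)
  linarith

theorem integrableOn_inner {V S₀ : EuclideanSpace ℝ (Fin d) → EuclideanSpace ℝ (Fin d)}
    (hΩ : IsOpen Ω) (hV : V ∈ lipOne Ω) {B : ℝ} (hB : ∀ x ∈ Ω, ‖V x‖ ≤ B)
    (hS₀ : IntegrableOn S₀ Ω volume) :
    IntegrableOn (fun x => inner ℝ (S₀ x) (V x)) Ω volume := by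
  refine Integrable.mono' (hS₀.norm.mul_const B)
    (hS₀.aestronglyMeasurable.inner (aestronglyMeasurable_of_mem_lipOne hΩ hV)) ?_
  filter_upwards [ae_restrict_mem hΩ.measurableSet] with x hx
  exact (norm_inner_le_norm _ _).trans (by gcongr; exact hB x hx)

theorem setIntegral_frobenius_add_inner
    {V S₀ : EuclideanSpace ℝ (Fin d) → EuclideanSpace ℝ (Fin d)}
    {S₁ : EuclideanSpace ℝ (Fin d) → Matrix (Fin d) (Fin d) ℝ}
    (hΩ : IsOpen Ω) (hV : V ∈ lipOne Ω) {B : ℝ} (hB : ∀ x ∈ Ω, ‖V x‖ ≤ B)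
    (hS₁ : ∀ i j, IntegrableOn (fun x => S₁ x i j) Ω volume) (hS₀ : IntegrableOn S₀ Ω volume) :
    ∫ x in Ω, (frobenius (S₁ x) (jacobian V x) + inner ℝ (S₀ x) (V x)) =
      (∑ i, ∑ j, ∫ x in Ω, S₁ x i j * jacobian V x i j) + ∫ x in Ω, inner ℝ (S₀ x) (V x) := by
  have hi : ∀ i j, Integrable (fun x => S₁ x i j * jacobian V x i j) (volume.restrict Ω) :=
    fun i j => integrableOn_mul_jacobian hΩ hV (hS₁ i j) i j
  unfold frobenius
  rw [integral_add (integrable_finsetSum _ fun i _ => integrable_finsetSum _ fun j _ => hi i j)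
      (integrableOn_inner hΩ hV hB hS₀),
    integral_finsetSum _ fun i _ => integrable_finsetSum _ fun j _ => hi i j]
  simp_rw [fun i => integral_finsetSum Finset.univ fun j _ => hi i j]

/-- The weak-* sequential compactness of `Lip₁(Ω; ℝ^d)` in the form used for linear functionals
`V ↦ ∫_Ω S₁ : DV + S₀ ⋅ V` with integrable densities. -/
theorem exists_subseq_tendsto_functional (hΩ : IsOpen Ω) (hb : Bornology.IsBounded Ω)
    {V : ℕ → EuclideanSpace ℝ (Fin d) → EuclideanSpace ℝ (Fin d)} (hV : ∀ n, V n ∈ lipOne Ω)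
    {a : EuclideanSpace ℝ (Fin d)} (ha : a ∈ Ω) {M : ℝ} (hM : ∀ n, ‖V n a‖ ≤ M) :
    ∃ W ∈ lipOne Ω, ∃ φ : ℕ → ℕ, StrictMono φ ∧
      (∀ x ∈ Ω, Tendsto (fun n => V (φ n) x) atTop (𝓝 (W x))) ∧
      ∀ (S₁ : EuclideanSpace ℝ (Fin d) → Matrix (Fin d) (Fin d) ℝ)
        (S₀ : EuclideanSpace ℝ (Fin d) → EuclideanSpace ℝ (Fin d)),
        (∀ i j, IntegrableOn (fun x => S₁ x i j) Ω volume) → IntegrableOn S₀ Ω volume →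
        Tendsto (fun n => ∫ x in Ω,
            (frobenius (S₁ x) (jacobian (V (φ n)) x) + inner ℝ (S₀ x) (V (φ n) x))) atTop
          (𝓝 (∫ x in Ω, (frobenius (S₁ x) (jacobian W x) + inner ℝ (S₀ x) (W x)))) := by
  obtain ⟨W, hW, φ, hφ, hlim, hjac⟩ := exists_subseq_tendsto_of_lipOne hΩ hV ha hM
  obtain ⟨B, hB⟩ := exists_bound_of_isBounded hb ha M
  have hWa : ‖W a‖ ≤ M :=
    le_of_tendsto (hlim a ha).norm (Eventually.of_forall fun n => hM (φ n))
  refine ⟨W, hW, φ, hφ, hlim, fun S₁ S₀ hS₁ hS₀ => ?_⟩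
  simp_rw [fun n => setIntegral_frobenius_add_inner hΩ (hV (φ n)) (hB _ (hV (φ n)) (hM (φ n)))
      hS₁ hS₀, setIntegral_frobenius_add_inner hΩ hW (hB _ hW hWa) hS₁ hS₀]
  refine (tendsto_finsetSum _ fun i _ => tendsto_finsetSum _ fun j _ =>
    hjac _ (hS₁ i j) i j).add ?_
  refine tendsto_integral_of_dominated_convergence (fun x => ‖S₀ x‖ * B)
    (fun n => hS₀.aestronglyMeasurable.inner (aestronglyMeasurable_of_mem_lipOne hΩ (hV (φ n))))
    (hS₀.norm.mul_const B) (fun n => ?_) ?_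
  · filter_upwards [ae_restrict_mem hΩ.measurableSet] with x hx
    exact (norm_inner_le_norm _ _).trans (by gcongr; exact hB _ (hV (φ n)) (hM (φ n)) x hx)
  · filter_upwards [ae_restrict_mem hΩ.measurableSet] with x hx
    exact tendsto_const_nhds.inner (hlim x hx)

/-! ### Admissible fields -/

/-- Let `y → s` in the Lipschitz inequality. Together with the converse below, this turns the
boundary condition into an inequality on `Ω`, and it also bounds the fields at a point. -/
theorem norm_le_of_mem_clampedFields {Γ : Set (EuclideanSpace ℝ (Fin d))} (hΓ : Γ ⊆ closure Ω)
    {V : EuclideanSpace ℝ (Fin d) → EuclideanSpace ℝ (Fin d)} (hV : V ∈ clampedFields Ω Γ)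
    {s : EuclideanSpace ℝ (Fin d)} (hs : s ∈ Γ) {x : EuclideanSpace ℝ (Fin d)} (hx : x ∈ Ω) :
    ‖V x‖ ≤ ‖x - s‖ := by
  have : (𝓝[Ω] s).NeBot := mem_closure_iff_nhdsWithin_neBot.1 (hΓ hs)
  have h1 : Tendsto (fun y => ‖V x - V y‖) (𝓝[Ω] s) (𝓝 ‖V x - 0‖) :=
    (tendsto_const_nhds.sub (hV.2 s hs)).norm
  have h2 : Tendsto (fun y => ‖x - y‖) (𝓝[Ω] s) (𝓝 ‖x - s‖) :=
    (tendsto_const_nhds.sub tendsto_id).norm.mono_left nhdsWithin_le_nhds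
  rw [sub_zero] at h1
  exact le_of_tendsto_of_tendsto h1 h2 (eventually_nhdsWithin_of_forall fun y hy => hV.1 x hx y hy)

theorem mem_clampedFields_of_norm_le {Γ : Set (EuclideanSpace ℝ (Fin d))}
    {V : EuclideanSpace ℝ (Fin d) → EuclideanSpace ℝ (Fin d)} (hV : V ∈ lipOne Ω)
    (h : ∀ s ∈ Γ, ∀ x ∈ Ω, ‖V x‖ ≤ ‖x - s‖) : V ∈ clampedFields Ω Γ := by
  refine ⟨hV, fun s hs => squeeze_zero_norm' (eventually_nhdsWithin_of_forall (h s hs)) ?_⟩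
  have : Tendsto (fun y => ‖y - s‖) (𝓝 s) (𝓝 ‖s - s‖) := (tendsto_id.sub tendsto_const_nhds).norm
  rw [sub_self, norm_zero] at this
  exact this.mono_left nhdsWithin_le_nhds

theorem clampedFields_of_tendsto {Γ : Set (EuclideanSpace ℝ (Fin d))} (hΓ : Γ ⊆ closure Ω)
    {V : ℕ → EuclideanSpace ℝ (Fin d) → EuclideanSpace ℝ (Fin d)}
    (hV : ∀ n, V n ∈ clampedFields Ω Γ)
    {W : EuclideanSpace ℝ (Fin d) → EuclideanSpace ℝ (Fin d)} (hW : W ∈ lipOne Ω)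
    (hlim : ∀ x ∈ Ω, Tendsto (fun n => V n x) atTop (𝓝 (W x))) : W ∈ clampedFields Ω Γ :=
  mem_clampedFields_of_norm_le hW fun _ hs x hx =>
    le_of_tendsto (hlim x hx).norm
      (Eventually.of_forall fun n => norm_le_of_mem_clampedFields hΓ (hV n) hs hx)

theorem abs_divergence_le {V : EuclideanSpace ℝ (Fin d) → EuclideanSpace ℝ (Fin d)}
    (hΩ : IsOpen Ω) (hV : V ∈ lipOne Ω) {x : EuclideanSpace ℝ (Fin d)} (hx : x ∈ Ω) :
    |divergence V x| ≤ d := by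
  refine (Finset.abs_sum_le_sum_abs (fun i => jacobian V x i i) Finset.univ).trans ?_
  simpa using Finset.sum_le_sum fun i (_ : i ∈ Finset.univ) => abs_jacobian_le hΩ hV hx i i

theorem measurable_divergence (V : EuclideanSpace ℝ (Fin d) → EuclideanSpace ℝ (Fin d)) :
    Measurable (divergence V) :=
  Finset.univ.measurable_fun_sum (f := fun i x => jacobian V x i i) fun i _ =>
    measurable_jacobian V i i

theorem integrableOn_add_divergence_smul
    {V : EuclideanSpace ℝ (Fin d) → EuclideanSpace ℝ (Fin d)}
    (hΩ : IsOpen Ω) (hb : Bornology.IsBounded Ω) (hV : V ∈ lipOne Ω) :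
    IntegrableOn (fun x => V x + divergence V x • x) Ω volume := by
  rcases Ω.eq_empty_or_nonempty with rfl | ⟨a, ha⟩
  · simp
  obtain ⟨B, hB⟩ := exists_bound_of_isBounded hb ha ‖V a‖
  obtain ⟨R, hR⟩ := hb.exists_norm_le
  refine IntegrableOn.of_bound hb.measure_lt_top
    ((aestronglyMeasurable_of_mem_lipOne hΩ hV).add
      ((measurable_divergence V).aestronglyMeasurable.smul aestronglyMeasurable_id)) (B + d * R) ?_
  filter_upwards [ae_restrict_mem hΩ.measurableSet] with x hx
  refine (norm_add_le _ _).trans ?_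
  rw [norm_smul]
  gcongr
  · exact hB V hV le_rfl x hx
  · exact abs_divergence_le hΩ hV hx
  · exact hR x hx

/-- Fields fixing the centre of mass are uniformly bounded at each point. -/
theorem exists_bound_of_centredFields (hΩ : IsOpen Ω) (hb : Bornology.IsBounded Ω)
    {a : EuclideanSpace ℝ (Fin d)} (ha : a ∈ Ω) : ∃ M, ∀ V ∈ centredFields Ω, ‖V a‖ ≤ M := by
  obtain ⟨R, hR⟩ := hb.exists_norm_le
  -- `R + R` bounds `‖a - x‖`, hence `‖V a - V x‖`; `d * R` bounds `‖divergence V x • x‖`.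
  refine ⟨R + R + d * R, fun V hV => ?_⟩
  have hpos : 0 < volume.real Ω :=
    ENNReal.toReal_pos (hΩ.measure_pos volume ⟨a, ha⟩).ne' hb.measure_lt_top.ne
  have hi := integrableOn_add_divergence_smul hΩ hb hV.1
  have hconst : IntegrableOn (fun _ : EuclideanSpace ℝ (Fin d) => V a) Ω volume :=
    integrableOn_const hb.measure_lt_top.ne
  -- The constraint allows subtracting an integral equal to zero, leaving only differences of `V`.
  have heq : volume.real Ω • V a = ∫ x in Ω, (V a - (V x + divergence V x • x)) := by
    rw [integral_sub hconst hi, hV.2, sub_zero, setIntegral_const]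
  have hle : ‖∫ x in Ω, (V a - (V x + divergence V x • x))‖ ≤ (R + R + d * R) * volume.real Ω := by
    refine norm_setIntegral_le_of_norm_le_const hb.measure_lt_top fun x hx => ?_
    rw [← sub_sub]
    refine (norm_sub_le _ _).trans ?_
    rw [norm_smul]
    gcongr
    · exact (hV.1 a ha x hx).trans ((norm_sub_le _ _).trans (add_le_add (hR a ha) (hR x hx)))
    · exact abs_divergence_le hΩ hV.1 hx
    · exact hR x hx
  rw [← heq, norm_smul, Real.norm_of_nonneg hpos.le, mul_comm] at hle
  exact le_of_mul_le_mul_right hle hpos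

/-- Exhibits each coordinate of the constraint as a functional with densities `S₁ = x k • 1` and
constant `S₀`, so that functional convergence makes the constraint closed. -/
theorem integral_add_divergence_smul_apply
    {V : EuclideanSpace ℝ (Fin d) → EuclideanSpace ℝ (Fin d)}
    (hΩ : IsOpen Ω) (hb : Bornology.IsBounded Ω) (hV : V ∈ lipOne Ω) (k : Fin d) :
    (∫ x in Ω, (V x + divergence V x • x)) k =
      ∫ x in Ω, (frobenius (x k • (1 : Matrix (Fin d) (Fin d) ℝ)) (jacobian V x) +
        inner ℝ (EuclideanSpace.single k (1 : ℝ)) (V x)) := by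
  have h := (EuclideanSpace.proj (𝕜 := ℝ) k).integral_comp_comm
    (integrableOn_add_divergence_smul hΩ hb hV)
  refine h.symm.trans (integral_congr_ae (Eventually.of_forall fun x => ?_))
  simp [frobenius, divergence, Matrix.trace, Matrix.one_apply, Finset.mul_sum, mul_comm, add_comm,
    EuclideanSpace.inner_single_left]

theorem centredFields_of_tendsto (hΩ : IsOpen Ω) (hb : Bornology.IsBounded Ω)
    {V : ℕ → EuclideanSpace ℝ (Fin d) → EuclideanSpace ℝ (Fin d)}
    (hV : ∀ n, V n ∈ centredFields Ω)
    {W : EuclideanSpace ℝ (Fin d) → EuclideanSpace ℝ (Fin d)} (hW : W ∈ lipOne Ω)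
    (hlim : ∀ (S₁ : EuclideanSpace ℝ (Fin d) → Matrix (Fin d) (Fin d) ℝ)
        (S₀ : EuclideanSpace ℝ (Fin d) → EuclideanSpace ℝ (Fin d)),
        (∀ i j, IntegrableOn (fun x => S₁ x i j) Ω volume) → IntegrableOn S₀ Ω volume →
        Tendsto (fun n => ∫ x in Ω,
            (frobenius (S₁ x) (jacobian (V n) x) + inner ℝ (S₀ x) (V n x))) atTop
          (𝓝 (∫ x in Ω, (frobenius (S₁ x) (jacobian W x) + inner ℝ (S₀ x) (W x))))) :
    W ∈ centredFields Ω := by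
  refine ⟨hW, ?_⟩
  ext k
  have hint : ∀ i j, IntegrableOn
      (fun x : EuclideanSpace ℝ (Fin d) => (x k • (1 : Matrix (Fin d) (Fin d) ℝ)) i j) Ω volume := by
    intro i j
    obtain ⟨R, hR⟩ := hb.exists_norm_le
    have hk : IntegrableOn (fun x : EuclideanSpace ℝ (Fin d) => x k) Ω volume := by
      refine Measure.integrableOn_of_bounded (M := R) hb.measure_lt_top.ne
        (EuclideanSpace.proj (𝕜 := ℝ) k).continuous.aestronglyMeasurable ?_
      filter_upwards [ae_restrict_mem hΩ.measurableSet] with x hx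
      exact (PiLp.norm_apply_le x k).trans (hR x hx)
    exact hk.mul_const _
  have h := hlim (fun x => x k • 1) (fun _ => EuclideanSpace.single k 1) hint
    (integrableOn_const hb.measure_lt_top.ne)
  rw [integral_add_divergence_smul_apply hΩ hb hW k]
  refine tendsto_nhds_unique h ?_
  simp_rw [fun n => (integral_add_divergence_smul_apply hΩ hb (hV n).1 k).symm, fun n => (hV n).2]
  exact tendsto_const_nhds

theorem zero_mem_lipOne : (0 : EuclideanSpace ℝ (Fin d) → EuclideanSpace ℝ (Fin d)) ∈ lipOne Ω := by
  intro x _ y _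
  simp

theorem zero_mem_centredFields :
    (0 : EuclideanSpace ℝ (Fin d) → EuclideanSpace ℝ (Fin d)) ∈ centredFields Ω :=
  ⟨zero_mem_lipOne, by simp [divergence, jacobian, Matrix.trace]⟩

theorem zero_mem_clampedFields (Γ : Set (EuclideanSpace ℝ (Fin d))) :
    (0 : EuclideanSpace ℝ (Fin d) → EuclideanSpace ℝ (Fin d)) ∈ clampedFields Ω Γ :=
  ⟨zero_mem_lipOne, fun _ _ => tendsto_const_nhds⟩

end ShapeOpt

/-! ### The direct method and the conclusion. -/

/-- A real function has a minimizer on a nonempty set as soon as every sequence in the set has a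
subsequence along which the values converge to a value attained in the set. -/
theorem exists_isGLB_of_forall_seq {α : Type*} {s : Set α} (hs : s.Nonempty) {F : α → ℝ}
    (h : ∀ u : ℕ → α, (∀ n, u n ∈ s) → ∃ a ∈ s, ∃ φ : ℕ → ℕ, StrictMono φ ∧
      Tendsto (fun n => F (u (φ n))) atTop (𝓝 (F a))) :
    ∃ a ∈ s, IsGLB (F '' s) (F a) := by
  have hbdd : BddBelow (F '' s) := by
    -- Otherwise values below `-n` could not have a subsequence with a finite limit.
    by_contra hcon
    have hex : ∀ n : ℕ, ∃ a ∈ s, F a < -n := fun n => by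
      simpa using not_bddBelow_iff.1 hcon (-n)
    choose u hus hu using hex
    obtain ⟨a, -, φ, hφ, hlim⟩ := h u hus
    refine not_tendsto_nhds_of_tendsto_atBot ?_ _ hlim
    exact tendsto_atBot_mono (fun n => (hu (φ n)).le)
      (tendsto_neg_atTop_atBot.comp (tendsto_natCast_atTop_atTop.comp hφ.tendsto_atTop))
  obtain ⟨v, -, hv, hvs⟩ := exists_seq_tendsto_sInf (hs.image F) hbdd
  choose u hus hu using hvs
  obtain ⟨a, ha, φ, hφ, hlim⟩ := h u hus
  refine ⟨a, ha, ?_⟩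
  simp_rw [hu] at hlim
  rw [tendsto_nhds_unique hlim (hv.comp hφ.tendsto_atTop)]
  exact isGLB_csInf (hs.image F) hbdd

theorem proposition2p8 {d : ℕ}
    (𝒮 : Set (Set (EuclideanSpace ℝ (Fin d))))
    (J : Set (EuclideanSpace ℝ (Fin d)) → ℝ)
    (Ω : Set (EuclideanSpace ℝ (Fin d)))
    (hΩ𝒮 : Ω ∈ 𝒮) (hΩopen : IsOpen Ω) (hΩconn : IsConnected Ω)
    (hΩbdd : Bornology.IsBounded Ω)
    (S₁ : EuclideanSpace ℝ (Fin d) → Matrix (Fin d) (Fin d) ℝ)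
    (S₀ : EuclideanSpace ℝ (Fin d) → EuclideanSpace ℝ (Fin d))
    (hS₁ : ∀ i j, IntegrableOn (fun x => S₁ x i j) Ω volume)
    (hS₀ : IntegrableOn S₀ Ω volume)
    (U : Set (EuclideanSpace ℝ (Fin d) → EuclideanSpace ℝ (Fin d)))
    (hU : U = ShapeOpt.centredFields Ω ∨
      ∃ Γ : Set (EuclideanSpace ℝ (Fin d)), Γ ⊆ frontier Ω ∧ Γ.Nonempty ∧
        U = ShapeOpt.clampedFields Ω Γ)
    (hJ : ∀ V ∈ U, ShapeOpt.ShapeDifferentiableAt 𝒮 J Ω V ∧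
      ShapeOpt.shapeDeriv J Ω V =
        ∫ x in Ω, (ShapeOpt.frobenius (S₁ x) (ShapeOpt.jacobian V x) + inner ℝ (S₀ x) (V x))) :
    ∃ V ∈ U, IsGLB {r : ℝ | ∃ V' ∈ U, r = ShapeOpt.shapeDeriv J Ω V'}
      (ShapeOpt.shapeDeriv J Ω V) := by
  obtain ⟨a, ha⟩ := hΩconn.nonempty
  have hne : U.Nonempty := by
    rcases hU with rfl | ⟨Γ, -, -, rfl⟩
    · exact ⟨0, ShapeOpt.zero_mem_centredFields⟩
    · exact ⟨0, ShapeOpt.zero_mem_clampedFields Γ⟩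
  have hUlip : ∀ V ∈ U, V ∈ ShapeOpt.lipOne Ω := by
    rcases hU with rfl | ⟨Γ, -, -, rfl⟩ <;> exact fun V hV => hV.1
  obtain ⟨M, hM⟩ : ∃ M, ∀ V ∈ U, ‖V a‖ ≤ M := by
    rcases hU with rfl | ⟨Γ, hΓ, ⟨s, hs⟩, rfl⟩
    · exact ShapeOpt.exists_bound_of_centredFields hΩopen hΩbdd ha
    · exact ⟨‖a - s‖, fun V hV => ShapeOpt.norm_le_of_mem_clampedFields
        (hΓ.trans frontier_subset_closure) hV hs ha⟩
  have hset : {r : ℝ | ∃ V' ∈ U, r = ShapeOpt.shapeDeriv J Ω V'} = ShapeOpt.shapeDeriv J Ω '' U := by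
    ext r
    simp [eq_comm]
  rw [hset]
  refine exists_isGLB_of_forall_seq hne fun V hV => ?_
  obtain ⟨W, hW, φ, hφ, hlim, hF⟩ := ShapeOpt.exists_subseq_tendsto_functional hΩopen hΩbdd
    (fun n => hUlip _ (hV n)) ha (fun n => hM _ (hV n))
  have hWU : W ∈ U := by
    rcases hU with rfl | ⟨Γ, hΓ, -, rfl⟩
    · exact ShapeOpt.centredFields_of_tendsto hΩopen hΩbdd (fun n => hV (φ n)) hW hF
    · exact ShapeOpt.clampedFields_of_tendsto (hΓ.trans frontier_subset_closure)
        (fun n => hV (φ n)) hW hlim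
  refine ⟨W, hWU, φ, hφ, ?_⟩
  -- The integral formula is available only on `U`, hence `hWU` is needed first.
  simp_rw [fun n => (hJ _ (hV (φ n))).2, (hJ W hWU).2]
  exact hF S₁ S₀ hS₁ hS₀
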